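/- \textbf{Setting.} Let $U$ be a compact metric space, $Y\subset\mathbb R^m$ and $Z\subset\mathbb R^n$ compact, $C>0$, $z_0\in Z$, and let $f:U\times\mathbb R^m\times\mathbb R^n\to\mathbb R^m$, $g:U\times\mathbb R^m\times\mathbb R^n\to\mathbb R^n$, $G:U\times\mathbb R^m\times\mathbb R^n\to\mathbb R$ be continuous. $\mathcal P(X)$ denotes the Borel probability measures on $X$ with the weak$^*$ topology. Absolute continuity on $[0,\infty)$ means absolute continuity on every $[0,T]$. For $z\in Z$, an \emph{admissible pair of the associated system} is a measurable $u:[0,\infty)\to U$ and an absolutely continuous $y:[0,\infty)\to Y$ with $y'(\tau)=f(u(\tau),y(\tau),z)$ for a.a. $\tau\ge 0$. Let $$W(z)=\Big\{\mu\in\mathcal P(U\times Y):\int \nabla\phi(y)^Tf(u,y,z)\,\mu(du,dy)=0\ \ \forall \phi\in C^1(\mathbb R^m)\Big\},\qquad F=\{(\mu,z):z\in Z,\ \mu\in W(z)\},$$ $\tilde g(\mu,z)=\int g(u,y,z)\,\mu(du,dy)$ and $\tilde G(\mu,z)=\int G(u,y,z)\,\mu(du,dy)$. An \emph{admissible pair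 of the averaged system} is a measurable $\mu:[0,\infty)\to\mathcal P(U\times Y)$ and an absolutely continuous $z:[0,\infty)\to Z$ with $\mu(t)\in W(z(t))$ and $z'(t)=\tilde g(\mu(t),z(t))$ for a.a. $t\ge0$. Let $\tilde V^*(z_0)$ be the infimum of $\int_0^\infty e^{-Ct}\tilde G(\mu(t),z(t))\,dt$ over the admissible pairs of the averaged system with $z(0)=z_0$, and let $\tilde G^*(z_0)$ be the minimum of $\int_F\tilde G\,dp$ over all $p\in\mathcal P(F)$ such that $\int_F\big(\nabla\psi(z)^T\tilde g(\mu,z)+C(\psi(z_0)-\psi(z))\big)\,p(d\mu,dz)=0$ for all $\psi\in C^1(\mathbb R^n)$. Put $\tilde H(q,z)=\min_{\mu\in W(z)}\{\tilde G(\mu,z)+q^T\tilde g(\mu,z)\}$. A function $\zeta^*\in C^1(\mathbb R^n)$ is a \emph{solution of the averaged dual problem} if $\tilde G^*(z_0)\le\tilde H(\nabla\zeta^*(z),z)+C(\zeta^*(z_0)-\zeta^*(z))$ for all $z\in Z$. Given $\zeta^*$ and $z\in Z$, a function $\eta^*_z\in C^1(\mathbb R^m)$ is a \emph{solution of the associated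 dual problem} at $z$ if $\tilde H(\nabla\zeta^*(z),z)\le G(u,y,z)+\nabla\zeta^*(z)^Tg(u,y,z)+\nabla\eta_z^*(y)^Tf(u,y,z)$ for all $(u,y)\in U\times Y$. An \emph{average control generating (ACG) family} assigns to each $z\in Z$ an admissible pair $(u_z(\cdot),y_z(\cdot))$ of the associated system such that: (i) each pair generates an occupational measure $\mu(\cdot|z)\in\mathcal P(U\times Y)$ on $[0,\infty)$, i.e. $\frac1S\int_0^Sq(u_z(\tau),y_z(\tau))\,d\tau\to\int q\,d\mu(\cdot|z)$ as $S\to\infty$ for all $q\in C(U\times Y)$; (ii) for every $q\in C(U\times Y\times Z)$ the function $z\mapsto\int q(u,y,z)\,\mu(du,dy|z)$ is Borel measurable on $Z$ and there is $\phi_q$ with $\phi_q(S)\to0$ as $S\to\infty$ and $\big|\frac1S\int_0^Sq(u_z(\tau),y_z(\tau),z)\,d\tau-\int q(u,y,z)\,\mu(du,dy|z)\big|\le\phi_q(S)$ for all $S>0$, $z\in Z$; (iii) the equation $z'(t)=\tilde g(\mu(\cdot|z(t)),z(t))$, $z(0)=z_0$, has a unique absolutely continuous solution $z(\cdot)$ on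 $[0,\infty)$ with values in $Z$ (the equation being understood for a.a. $t$). The family is \emph{optimal} if $\int_0^\infty e^{-Ct}\tilde G(\mu(\cdot|z(t)),z(t))\,dt=\tilde V^*(z_0)$. \textbf{Proposition.} Assume that $C\,\tilde V^*(z_0)=\tilde G^*(z_0)$, that $\zeta^*$ is a solution of the averaged dual problem and that, for every $z\in Z$, $\eta^*_z$ is a solution of the associated dual problem at $z$. Let $(u_z(\cdot),y_z(\cdot))$ be an optimal ACG family, with corresponding solution $z(\cdot)$ of the equation in (iii), that is periodic: $(u_z(\tau+T_z),y_z(\tau+T_z))=(u_z(\tau),y_z(\tau))$ for all $\tau\ge0$, with some $T_z>0$ (it suffices that this holds for $z=z(t)$, $t\ge0$). Then, for almost all $t\in[0,\infty)$ and almost all $\tau\in[0,T_{z(t)}]$, $$u_{z(t)}(\tau)\in\operatorname*{Argmin}_{u\in U}\Big\{G(u,y_{z(t)}(\tau),z(t))+\nabla\zeta^*(z(t))^Tg(u,y_{z(t)}(\tau),z(t))+\nabla\eta^*_{z(t)}(y_{z(t)}(\tau))^Tf(u,y_{z(t)}(\tau),z(t))\Big\}.$$ -/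

import Mathlib

open MeasureTheory Set Filter Topology

noncomputable section

namespace SlowFast

/-- Euclidean space `ℝᵏ`. -/
abbrev E (k : ℕ) : Type := EuclideanSpace ℝ (Fin k)

/-- The data of the singularly perturbed discounted problem
`ε y' = f(u,y,z)`, `z' = g(u,y,z)`, with running cost `G` and discount rate `C > 0`, where the
controls are `U`-valued and the fast and slow state variables live in the compact sets
`Y ⊆ ℝᵐ` and `Z ⊆ ℝⁿ`. -/
structure Problem (U : Type*) [TopologicalSpace U] (m n : ℕ) where
  Y : Set (E m)
  Z : Set (E n)
  isCompact_Y : IsCompact Y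
  isCompact_Z : IsCompact Z
  f : U → E m → E n → E m
  g : U → E m → E n → E n
  G : U → E m → E n → ℝ
  continuous_f : Continuous fun x : U × E m × E n => f x.1 x.2.1 x.2.2
  continuous_g : Continuous fun x : U × E m × E n => g x.1 x.2.1 x.2.2
  continuous_G : Continuous fun x : U × E m × E n => G x.1 x.2.1 x.2.2
  C : ℝ
  C_pos : 0 < C

/-- `x` is absolutely continuous on every interval `[0, T]` and `x'(t) = v(t)` for almost all
`t ≥ 0`. -/
def IsACSolution {k : ℕ} (x v : ℝ → E k) : Prop :=
  (∀ T : ℝ, 0 ≤ T → AbsolutelyContinuousOnInterval x 0 T) ∧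
    ∀ᵐ t ∂(volume.restrict (Ici (0 : ℝ))), HasDerivAt x (v t) t

variable {U : Type*} [MetricSpace U] [MeasurableSpace U] [BorelSpace U] {m n : ℕ}

namespace Problem

/-- Admissible pair (on `[0, ∞)`) of the associated system `y'(τ) = f(u(τ), y(τ), z)` with
frozen `z`. The values of `u`, `y` at negative times are irrelevant. -/
def IsAssociatedAdmissible (P : Problem U m n) (z : P.Z) (u : ℝ → U) (y : ℝ → P.Y) : Prop :=
  AEMeasurable u (volume.restrict (Ici (0 : ℝ))) ∧
    IsACSolution (fun τ => (y τ : E m)) (fun τ => P.f (u τ) (y τ) z)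

/-- The set `W(z)` of probability measures `μ` on `U × Y` with
`∫ ∇φ(y)ᵀ f(u,y,z) μ(du,dy) = 0` for all `φ ∈ C¹(ℝᵐ)`. -/
def W (P : Problem U m n) (z : P.Z) : Set (ProbabilityMeasure (U × P.Y)) :=
  {μ | ∀ φ : E m → ℝ, ContDiff ℝ 1 φ →
    ∫ w, inner ℝ (gradient φ (w.2 : E m)) (P.f w.1 w.2 z) ∂(μ : Measure (U × P.Y)) = 0}

/-- `g̃(μ, z) = ∫ g(u,y,z) μ(du,dy)`. -/
def gTilde (P : Problem U m n) (μ : ProbabilityMeasure (U × P.Y)) (z : P.Z) : E n :=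
  ∫ w, P.g w.1 w.2 z ∂(μ : Measure (U × P.Y))

/-- `G̃(μ, z) = ∫ G(u,y,z) μ(du,dy)`. -/
def GTilde (P : Problem U m n) (μ : ProbabilityMeasure (U × P.Y)) (z : P.Z) : ℝ :=
  ∫ w, P.G w.1 w.2 z ∂(μ : Measure (U × P.Y))

/-- Admissible pair (on `[0, ∞)`) of the averaged system `z' = g̃(μ(t), z(t))`,
`μ(t) ∈ W(z(t))`, `z(t) ∈ Z`. -/
def IsAveragedAdmissible (P : Problem U m n) (μ : ℝ → ProbabilityMeasure (U × P.Y))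
    (z : ℝ → P.Z) : Prop :=
  AEMeasurable μ (volume.restrict (Ici (0 : ℝ))) ∧
    (∀ᵐ t ∂(volume.restrict (Ici (0 : ℝ))), μ t ∈ P.W (z t)) ∧
    IsACSolution (fun t => (z t : E n)) (fun t => P.gTilde (μ t) (z t))

/-- The discounted cost `∫₀^∞ e^{-Ct} G̃(μ(t), z(t)) dt`. -/
def averagedCost (P : Problem U m n) (μ : ℝ → ProbabilityMeasure (U × P.Y)) (z : ℝ → P.Z) : ℝ :=
  ∫ t in Ici (0 : ℝ), Real.exp (-P.C * t) * P.GTilde (μ t) (z t)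

/-- The optimal value of the averaged problem: the infimum of the discounted cost over the
admissible pairs of the averaged system starting at `z₀`. -/
def averagedValue (P : Problem U m n) (z₀ : P.Z) : ℝ :=
  sInf {J | ∃ (μ : ℝ → ProbabilityMeasure (U × P.Y)) (z : ℝ → P.Z),
    P.IsAveragedAdmissible μ z ∧ z 0 = z₀ ∧ J = P.averagedCost μ z}

/-- The graph `F` of `W(·)`, a subset of `𝒫(U × Y) × Z`. -/
def graphW (P : Problem U m n) : Set (ProbabilityMeasure (U × P.Y) × P.Z) :=
  {x | x.1 ∈ P.W x.2}

/-- The feasible set of the averaged infinite-dimensional LP problem: probability measures `p`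
on `F` with `∫ (∇ψ(z)ᵀ g̃(μ,z) + C (ψ(z₀) - ψ(z))) p(dμ,dz) = 0` for all `ψ ∈ C¹(ℝⁿ)`. -/
def averagedLPFeasible (P : Problem U m n) (z₀ : P.Z) : Set (ProbabilityMeasure P.graphW) :=
  {p | ∀ ψ : E n → ℝ, ContDiff ℝ 1 ψ →
    ∫ x, (inner ℝ (gradient ψ (x.1.2 : E n)) (P.gTilde x.1.1 x.1.2)
      + P.C * (ψ z₀ - ψ x.1.2)) ∂(p : Measure P.graphW) = 0}

/-- The optimal value of the averaged infinite-dimensional LP problem. -/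
def averagedLPValue (P : Problem U m n) (z₀ : P.Z) : ℝ :=
  sInf ((fun p : ProbabilityMeasure P.graphW =>
    ∫ x, P.GTilde x.1.1 x.1.2 ∂(p : Measure P.graphW)) '' P.averagedLPFeasible z₀)

/-- The Hamiltonian of the averaged system,
`H̃(q, z) = min_{μ ∈ W(z)} (G̃(μ,z) + qᵀ g̃(μ,z))`. -/
def HTilde (P : Problem U m n) (q : E n) (z : P.Z) : ℝ :=
  sInf ((fun μ => P.GTilde μ z + inner ℝ q (P.gTilde μ z)) '' P.W z)

/-- `ζ` is a (continuously differentiable) solution of the averaged dual problem. -/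
def IsAveragedDualSolution (P : Problem U m n) (z₀ : P.Z) (ζ : E n → ℝ) : Prop :=
  ContDiff ℝ 1 ζ ∧
    ∀ z : P.Z, P.averagedLPValue z₀ ≤ P.HTilde (gradient ζ (z : E n)) z + P.C * (ζ z₀ - ζ z)

/-- The expression `G(u,y,z) + ∇ζ(z)ᵀ g(u,y,z) + ∇η(y)ᵀ f(u,y,z)`. -/
def dualIntegrand (P : Problem U m n) (ζ : E n → ℝ) (η : E m → ℝ) (u : U) (y : E m) (z : E n) :
    ℝ :=
  P.G u y z + inner ℝ (gradient ζ z) (P.g u y z) + inner ℝ (gradient η y) (P.f u y z)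

/-- `η` is a (continuously differentiable) solution of the associated dual problem at `z`
(the problem being defined by `ζ`). -/
def IsAssociatedDualSolution (P : Problem U m n) (ζ : E n → ℝ) (z : P.Z) (η : E m → ℝ) : Prop :=
  ContDiff ℝ 1 η ∧
    ∀ (u : U) (y : P.Y), P.HTilde (gradient ζ (z : E n)) z ≤ P.dualIntegrand ζ η u y z

/-- `μ` is the occupational measure generated by `(u(·), y(·))` on `[0, ∞)`. -/
def IsOccupationalMeasure (P : Problem U m n) (u : ℝ → U) (y : ℝ → P.Y)
    (μ : ProbabilityMeasure (U × P.Y)) : Prop :=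
  ∀ q : C(U × P.Y, ℝ),
    Tendsto (fun S : ℝ => S⁻¹ * ∫ τ in (0 : ℝ)..S, q (u τ, y τ)) atTop
      (𝓝 (∫ w, q w ∂(μ : Measure (U × P.Y))))

/-- `z(·)` is a solution on `[0, ∞)`, with values in `Z`, of
`z'(t) = g̃(μ(·|z(t)), z(t))`, `z(0) = z₀`. -/
def IsAveragedTrajectory (P : Problem U m n) (z₀ : P.Z)
    (μ : P.Z → ProbabilityMeasure (U × P.Y)) (z : ℝ → P.Z) : Prop :=
  z 0 = z₀ ∧ IsACSolution (fun t => (z t : E n)) (fun t => P.gTilde (μ (z t)) (z t))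

/-- `(u_z(·), y_z(·))`, `z ∈ Z`, is an average control generating (ACG) family, `μ(·|z)` is the
family of occupational measures it generates, and `z(·)` (here `zt`) is the corresponding unique
solution of the averaged equation. -/
structure IsACGFamily (P : Problem U m n) (z₀ : P.Z) (u : P.Z → ℝ → U) (y : P.Z → ℝ → P.Y)
    (μ : P.Z → ProbabilityMeasure (U × P.Y)) (zt : ℝ → P.Z) : Prop where
  admissible : ∀ z, P.IsAssociatedAdmissible z (u z) (y z)
  occupational : ∀ z, P.IsOccupationalMeasure (u z) (y z) (μ z)
  measurable : ∀ q : C(U × P.Y × P.Z, ℝ),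
    Measurable fun z => ∫ w, q (w.1, w.2, z) ∂(μ z : Measure (U × P.Y))
  uniform : ∀ q : C(U × P.Y × P.Z, ℝ), ∃ φ : ℝ → ℝ, Tendsto φ atTop (𝓝 0) ∧
    ∀ S : ℝ, 0 < S → ∀ z : P.Z,
      |S⁻¹ * (∫ τ in (0 : ℝ)..S, q (u z τ, y z τ, z))
        - ∫ w, q (w.1, w.2, z) ∂(μ z : Measure (U × P.Y))| ≤ φ S
  solution : P.IsAveragedTrajectory z₀ μ zt
  unique : ∀ zt' : ℝ → P.Z, P.IsAveragedTrajectory z₀ μ zt' → EqOn zt' zt (Ici 0)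

/-- Optimality of an ACG family: the generated pair `(μ(·|z(·)), z(·))` attains the optimal value
of the averaged problem. -/
def IsOptimalACG (P : Problem U m n) (z₀ : P.Z) (μ : P.Z → ProbabilityMeasure (U × P.Y))
    (zt : ℝ → P.Z) : Prop :=
  P.averagedCost (fun t => μ (zt t)) zt = P.averagedValue z₀

end Problem

/-- `(u(·), y(·))` is `T`-periodic on `[0, ∞)`, `T > 0`. -/
def IsPeriodicPair {A B : Type*} (T : ℝ) (u : ℝ → A) (y : ℝ → B) : Prop :=
  0 < T ∧ ∀ τ : ℝ, 0 ≤ τ → u (τ + T) = u τ ∧ y (τ + T) = y τ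

end SlowFast

end

/-!
Along an averaged admissible pair `(μ(·), z(·))` starting at `z₀`, the discounted integral of
`d/dt ζ(z(t)) + C (ζ(z₀) - ζ(z(t)))` vanishes. The discounted cost is therefore also the discounted
integral of `G̃ + ∇ζᵀ g̃ + C (ζ(z₀) - ζ(z))`, which by the averaged dual inequality is nowhere below
the value `G̃*(z₀)`. When the cost is `G̃*(z₀) / C`, a function bounded below by its weighted mean
must be constant, so `μ(t)` attains the minimum defining `H̃(∇ζ(z(t)), z(t))` for almost every `t`.

The same argument is then repeated on the fast time scale. The measures of `W(z)` do not see the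
term `∇ηᵀ f`, so the integral of the dual integrand against `μ(t)` is `H̃`; if `μ(t)` is generated
by a periodic pair, this integral is the mean over one period. Being bounded below by `H̃` through
the associated dual inequality, the dual integrand equals `H̃`, its minimum, almost everywhere on
the period.
-/

namespace SlowFast

section WeightedMean

variable {α : Type*} [MeasurableSpace α] {ν : Measure α}

theorem ae_eq_const_of_integral_mul_le {w h : α → ℝ} {c : ℝ} (hw : ∀ᵐ t ∂ν, 0 < w t)
    (hw_int : Integrable w ν) (hwh_int : Integrable (fun t => w t * h t) ν)
    (hc : ∀ᵐ t ∂ν, c ≤ h t) (hle : ∫ t, w t * h t ∂ν ≤ (∫ t, w t ∂ν) * c) :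
    ∀ᵐ t ∂ν, h t = c := by
  have hmono : (fun t => w t * c) ≤ᵐ[ν] fun t => w t * h t := by
    filter_upwards [hw, hc] with t hwt hct using mul_le_mul_of_nonneg_left hct hwt.le
  have hintegral : ∫ t, w t * c ∂ν = ∫ t, w t * h t ∂ν :=
    (integral_mono_ae (hw_int.mul_const c) hwh_int hmono).antisymm
      (hle.trans_eq (integral_mul_const c w).symm)
  filter_upwards [(integral_eq_iff_of_ae_le (hw_int.mul_const c) hwh_int hmono).1 hintegral, hw]
    with t ht hwt
  exact (mul_left_cancel₀ hwt.ne' ht).symm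

theorem integrableOn_exp_neg_mul_Ici {C : ℝ} (hC : 0 < C) (a : ℝ) :
    IntegrableOn (fun t => Real.exp (-C * t)) (Ici a) :=
  (integrableOn_Ici_iff_integrableOn_Ioi (by simp)).2 (exp_neg_integrableOn_Ioi a hC)

theorem integral_exp_neg_mul_Ici_zero {C : ℝ} (hC : 0 < C) :
    ∫ t in Ici (0 : ℝ), Real.exp (-C * t) = C⁻¹ := by
  rw [integral_Ici_eq_integral_Ioi, integral_exp_mul_Ioi (neg_lt_zero.2 hC)]
  simp

end WeightedMean

section ContinuousMeasurable

variable {X Ω : Type*} [TopologicalSpace X] [MeasurableSpace X] [MeasurableSpace Ω]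

theorem integrable_of_continuous_of_compactSpace [CompactSpace X] [OpensMeasurableSpace X]
    {F : Type*} [NormedAddCommGroup F] (ν : Measure X) [IsFiniteMeasureOnCompacts ν]
    {q : X → F} (hq : Continuous q) : Integrable q ν :=
  hq.integrable_of_hasCompactSupport (.of_compactSpace q)

theorem measurable_probabilityMeasure_of_integral [HasOuterApproxClosed X] [BorelSpace X]
    {κ : Ω → ProbabilityMeasure X}
    (h : ∀ q : C(X, ℝ), Measurable fun ω => ∫ x, q x ∂(κ ω : Measure X)) : Measurable κ := by
  refine Measurable.subtype_mk (f := fun ω => (κ ω : Measure X))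
    (.measure_of_isPiSystem_of_isProbabilityMeasure
      (BorelSpace.measurable_eq.trans borel_eq_generateFrom_isClosed) isPiSystem_isClosed
      fun s (hs : IsClosed s) => ?_)
  refine measurable_of_tendsto_metrizable (f := fun n ω => ∫⁻ x, hs.apprSeq n x ∂(κ ω : Measure X))
    (fun n => ?_) (tendsto_pi_nhds.2 fun ω => HasOuterApproxClosed.tendsto_lintegral_apprSeq hs _)
  have hlintegral : ∀ ω, ∫⁻ x, hs.apprSeq n x ∂(κ ω : Measure X) =
      ENNReal.ofReal (∫ x, (hs.apprSeq n x : ℝ) ∂(κ ω : Measure X)) := fun ω => by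
    rw [← BoundedContinuousFunction.toReal_lintegral_coe_eq_integral,
      ENNReal.ofReal_toReal (BoundedContinuousFunction.lintegral_lt_top_of_nnreal _ _).ne]
  simp only [hlintegral]
  exact (h ⟨fun x => (hs.apprSeq n x : ℝ), by fun_prop⟩).ennreal_ofReal

end ContinuousMeasurable

theorem stronglyMeasurable_integral_probabilityMeasure {X Z F : Type*} [MeasurableSpace X]
    [MeasurableSpace Z] [NormedAddCommGroup F] [NormedSpace ℝ F] {q : X → Z → F}
    (hq : StronglyMeasurable (Function.uncurry q)) :
    StronglyMeasurable fun p : ProbabilityMeasure X × Z =>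
      ∫ x, q x p.2 ∂(p.1 : Measure X) := by
  let κ : ProbabilityTheory.Kernel (ProbabilityMeasure X × Z) X :=
    ⟨fun p => p.1, measurable_subtype_coe.comp measurable_fst⟩
  have : ProbabilityTheory.IsMarkovKernel κ := ⟨fun p => p.1.2⟩
  exact StronglyMeasurable.integral_kernel_prod_right (κ := κ) (f := fun p x => q x p.2)
    (hq.comp_measurable (measurable_snd.prodMk (measurable_snd.comp measurable_fst)))

theorem integrable_mul_integral_probabilityMeasure {X Z Ω : Type*} [TopologicalSpace X]
    [CompactSpace X] [MeasurableSpace X] [OpensMeasurableSpace X] [TopologicalSpace Z]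
    [CompactSpace Z] [MeasurableSpace Z] [OpensMeasurableSpace Z]
    [SecondCountableTopologyEither X Z] [MeasurableSpace Ω] {ν : Measure Ω} {w : Ω → ℝ}
    (hw : Integrable w ν) {κ : Ω → ProbabilityMeasure X} (hκ : AEMeasurable κ ν) {z : Ω → Z}
    (hz : AEMeasurable z ν) {q : X × Z → ℝ} (hq : Continuous q) :
    Integrable (fun ω => w ω * ∫ x, q (x, z ω) ∂(κ ω : Measure X)) ν := by
  obtain ⟨B, hB⟩ := isCompact_univ.exists_bound_of_continuousOn hq.continuousOn
  have hmeas := (stronglyMeasurable_integral_probabilityMeasure (q := fun x z => q (x, z))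
    hq.stronglyMeasurable).measurable.comp_aemeasurable (hκ.prodMk hz)
  refine hw.mul_bdd (c := B) hmeas.aestronglyMeasurable (.of_forall fun ω => ?_)
  simpa using norm_integral_le_of_norm_le_const (μ := (κ ω : Measure X))
    (.of_forall fun x => hB (x, z ω) (mem_univ _))

section Periodic

variable {F : Type*} {f : ℝ → F} {T : ℝ}

theorem add_natCast_mul_period_eq (hT : 0 ≤ T) (hf : ∀ τ, 0 ≤ τ → f (τ + T) = f τ) (k : ℕ)
    {τ : ℝ} (hτ : 0 ≤ τ) : f (τ + k * T) = f τ := by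
  induction k with
  | zero => simp
  | succ k ih =>
    rw [← ih, ← hf (τ + k * T) (by positivity)]
    push_cast
    ring_nf

theorem sub_natCast_mul_period_eqOn (hT : 0 ≤ T) (hf : ∀ τ, 0 ≤ τ → f (τ + T) = f τ) (k : ℕ) :
    EqOn (fun τ => f (τ - k * T)) f (Ici (k * T)) := fun τ hτ => by
  simpa using (add_natCast_mul_period_eq hT hf k (sub_nonneg.2 hτ)).symm

variable [NormedAddCommGroup F]

theorem intervalIntegrable_natCast_mul_period (hT : 0 ≤ T) (hf : ∀ τ, 0 ≤ τ → f (τ + T) = f τ)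
    (hint : IntervalIntegrable f volume 0 T) (k : ℕ) :
    IntervalIntegrable f volume (k * T) ((k + 1 : ℕ) * T) := by
  have hshift := hint.comp_sub_right (k * T)
  rw [zero_add, show T + k * T = (k + 1 : ℕ) * T by push_cast; ring] at hshift
  refine hshift.congr fun τ hτ => sub_natCast_mul_period_eqOn hT hf k ?_
  rw [uIoc_of_le (by gcongr; simp)] at hτ
  exact hτ.1.le

variable [NormedSpace ℝ F]

theorem intervalIntegral_natCast_mul_period (hT : 0 ≤ T) (hf : ∀ τ, 0 ≤ τ → f (τ + T) = f τ)
    (hint : IntervalIntegrable f volume 0 T) (k : ℕ) :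
    ∫ τ in 0..k * T, f τ = k • ∫ τ in 0..T, f τ := by
  have hshift : ∀ i : ℕ, ∫ τ in i * T..(i + 1 : ℕ) * T, f τ = ∫ τ in 0..T, f τ := fun i => by
    have hle : i * T ≤ (i + 1 : ℕ) * T := by gcongr; simp
    calc ∫ τ in i * T..(i + 1 : ℕ) * T, f τ
        = ∫ τ in i * T..(i + 1 : ℕ) * T, f (τ - i * T) :=
          intervalIntegral.integral_congr fun τ hτ =>
            (sub_natCast_mul_period_eqOn hT hf i (uIcc_of_le hle ▸ hτ).1).symm
      _ = ∫ τ in 0..T, f τ := by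
          rw [intervalIntegral.integral_comp_sub_right]
          congr 1 <;> push_cast <;> ring
  have hsum := intervalIntegral.sum_integral_adjacent_intervals (a := fun i : ℕ => i * T) (n := k)
    fun i _ => intervalIntegrable_natCast_mul_period hT hf hint i
  simpa only [hshift, Finset.sum_const, Finset.card_range, Nat.cast_zero, zero_mul] using hsum.symm

theorem intervalIntegral_period_eq_of_tendsto_average {L : F} (hT : 0 < T)
    (hf : ∀ τ, 0 ≤ τ → f (τ + T) = f τ) (hint : IntervalIntegrable f volume 0 T)
    (hL : Tendsto (fun S : ℝ => S⁻¹ • ∫ τ in 0..S, f τ) atTop (𝓝 L)) :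
    ∫ τ in 0..T, f τ = T • L := by
  have hperiods : Tendsto (fun k : ℕ => (k : ℝ) * T) atTop atTop :=
    tendsto_natCast_atTop_atTop.atTop_mul_const hT
  have hconst : Tendsto (fun _ : ℕ => T⁻¹ • ∫ τ in 0..T, f τ) atTop (𝓝 L) := by
    refine (hL.comp hperiods).congr' ?_
    filter_upwards [eventually_ne_atTop 0] with k hk
    have hk' : (k : ℝ) ≠ 0 := Nat.cast_ne_zero.2 hk
    rw [Function.comp_apply, intervalIntegral_natCast_mul_period hT.le hf hint,
      ← Nat.cast_smul_eq_nsmul ℝ, smul_smul, mul_inv_rev, inv_mul_cancel_right₀ hk']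
  rw [← tendsto_nhds_unique tendsto_const_nhds hconst, smul_inv_smul₀ hT.ne']

end Periodic

section Calculus

theorem continuous_gradient_of_contDiff {F : Type*} [NormedAddCommGroup F] [InnerProductSpace ℝ F]
    [CompleteSpace F] {φ : F → ℝ} (hφ : ContDiff ℝ 1 φ) : Continuous (gradient φ) :=
  (InnerProductSpace.toDual ℝ F).symm.continuous.comp (hφ.continuous_fderiv one_ne_zero)

theorem absolutelyContinuousOnInterval_lipschitzOnWith_comp {X X' : Type*} [PseudoMetricSpace X]
    [PseudoMetricSpace X'] {φ : X → X'} {K : NNReal} {s : Set X} (hφ : LipschitzOnWith K φ s)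
    {x : ℝ → X} {a b : ℝ} (hx : AbsolutelyContinuousOnInterval x a b)
    (hxs : MapsTo x (uIcc a b) s) :
    AbsolutelyContinuousOnInterval (fun t => φ (x t)) a b := by
  rw [absolutelyContinuousOnInterval_iff] at hx ⊢
  intro ε hε
  obtain ⟨δ, hδ, h⟩ := hx (ε / (K + 1)) (by positivity)
  refine ⟨δ, hδ, fun I hI hIδ => ?_⟩
  have hmem : ∀ i ∈ Finset.range I.1, (I.2 i).1 ∈ uIcc a b ∧ (I.2 i).2 ∈ uIcc a b := hI.1
  calc ∑ i ∈ Finset.range I.1, dist (φ (x (I.2 i).1)) (φ (x (I.2 i).2))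
      ≤ ∑ i ∈ Finset.range I.1, K * dist (x (I.2 i).1) (x (I.2 i).2) :=
        Finset.sum_le_sum fun i hi =>
          hφ.dist_le_mul _ (hxs (hmem i hi).1) _ (hxs (hmem i hi).2)
    _ = K * ∑ i ∈ Finset.range I.1, dist (x (I.2 i).1) (x (I.2 i).2) := by
        rw [Finset.mul_sum]
    _ ≤ K * (ε / (K + 1)) := by
        gcongr
        exact (h I hI hIδ).le
    _ < (K + 1) * (ε / (K + 1)) := by
        gcongr
        exact lt_add_one _
    _ = ε := by field_simp

theorem absolutelyContinuousOnInterval_contDiff_comp {F F' : Type*} [NormedAddCommGroup F]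
    [NormedSpace ℝ F] [ProperSpace F] [NormedAddCommGroup F'] [NormedSpace ℝ F'] {φ : F → F'}
    (hφ : ContDiff ℝ 1 φ) {x : ℝ → F} {a b : ℝ} (hx : AbsolutelyContinuousOnInterval x a b) :
    AbsolutelyContinuousOnInterval (fun t => φ (x t)) a b := by
  obtain ⟨R, hR⟩ := hx.exists_bound
  obtain ⟨K, hK⟩ := (hφ.contDiffOn (s := Metric.closedBall 0 R)).exists_lipschitzOnWith
    one_ne_zero (convex_closedBall _ _) (isCompact_closedBall _ _)
  exact absolutelyContinuousOnInterval_lipschitzOnWith_comp hK hx fun t ht =>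
    mem_closedBall_zero_iff.2 (hR t ht)

theorem tendsto_mul_sub_of_abs_le {α : Type*} {l : Filter α} {w h : α → ℝ} {B : ℝ} (a : α)
    (hw : Tendsto w l (𝓝 0)) (hB : ∀ t, |h t| ≤ B) :
    Tendsto (fun t => w t * (h t - h a)) l (𝓝 0) :=
  hw.zero_mul_isBoundedUnder_le <|
    isBoundedUnder_of ⟨B + B, fun t => (norm_sub_le _ _).trans (add_le_add (hB t) (hB a))⟩

end Calculus

namespace IsACSolution

variable {k : ℕ} {x v : ℝ → E k} {φ : E k → ℝ}

theorem continuousOn (hx : IsACSolution x v) : ContinuousOn x (Ici 0) := by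
  intro t (ht : 0 ≤ t)
  have hcont := (hx.1 (t + 1) (by linarith)).continuousOn
  rw [uIcc_of_le (by linarith)] at hcont
  refine (hcont t ⟨ht, by linarith⟩).mono_of_mem_nhdsWithin ?_
  filter_upwards [self_mem_nhdsWithin, mem_nhdsWithin_of_mem_nhds (Iic_mem_nhds (lt_add_one t))]
    with s hs hs' using ⟨hs, hs'⟩

theorem aemeasurable_of_subtype {s : Set (E k)} {x : ℝ → s}
    (hx : IsACSolution (fun t => (x t : E k)) v) : AEMeasurable x (volume.restrict (Ici 0)) :=
  (IsInducing.subtypeVal.continuousOn_iff.2 hx.continuousOn).aemeasurable measurableSet_Ici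

theorem ae_hasDerivAt_comp (hx : IsACSolution x v) (hφ : ContDiff ℝ 1 φ) :
    ∀ᵐ t, t ∈ Ici (0 : ℝ) →
      HasDerivAt (fun s => φ (x s)) (inner ℝ (gradient φ (x t)) (v t)) t := by
  rw [← ae_restrict_iff' measurableSet_Ici]
  filter_upwards [hx.2] with t ht
  have hcomp :=
    (hφ.differentiable one_ne_zero (x t)).hasGradientAt.hasFDerivAt.comp_hasDerivAt t ht
  rwa [InnerProductSpace.toDual_apply_apply] at hcomp

theorem integral_inner_gradient (hx : IsACSolution x v) (hφ : ContDiff ℝ 1 φ) {S : ℝ}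
    (hS : 0 ≤ S) :
    ∫ t in 0..S, inner ℝ (gradient φ (x t)) (v t) = φ (x S) - φ (x 0) := by
  rw [← (absolutelyContinuousOnInterval_contDiff_comp hφ (hx.1 S hS)).integral_deriv_eq_sub]
  refine intervalIntegral.integral_congr_ae ?_
  filter_upwards [hx.ae_hasDerivAt_comp hφ] with t ht hmem
  rw [uIoc_of_le hS] at hmem
  exact (ht hmem.1.le).deriv.symm

theorem integral_exp_mul_inner_gradient (hx : IsACSolution x v) (hφ : ContDiff ℝ 1 φ) (C : ℝ)
    {S : ℝ} (hS : 0 ≤ S) :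
    ∫ t in 0..S, Real.exp (-C * t) *
        (inner ℝ (gradient φ (x t)) (v t) + C * (φ (x 0) - φ (x t))) =
      Real.exp (-C * S) * (φ (x S) - φ (x 0)) := by
  have hexp : AbsolutelyContinuousOnInterval (fun t => Real.exp (-C * t)) 0 S :=
    ContDiffOn.absolutelyContinuousOnInterval (by fun_prop)
  have hφ₀ : AbsolutelyContinuousOnInterval (fun t => φ (x t) - φ (x 0)) 0 S :=
    absolutelyContinuousOnInterval_contDiff_comp (hφ.sub contDiff_const) (hx.1 S hS)
  have hparts := hexp.integral_deriv_mul_eq_sub hφ₀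
  simp only [sub_self, mul_zero, sub_zero] at hparts
  rw [← hparts]
  refine intervalIntegral.integral_congr_ae ?_
  filter_upwards [hx.ae_hasDerivAt_comp hφ] with t ht hmem
  rw [uIoc_of_le hS] at hmem
  have hderiv : HasDerivAt (fun s => Real.exp (-C * s)) (Real.exp (-C * t) * -C) t := by
    simpa using ((hasDerivAt_id t).const_mul (-C)).exp
  rw [hderiv.deriv, ((ht hmem.1.le).sub_const _).deriv]
  ring

theorem tendsto_average_inner_gradient (hx : IsACSolution x v) (hφ : ContDiff ℝ 1 φ) {B : ℝ}
    (hB : ∀ t, |φ (x t)| ≤ B) :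
    Tendsto (fun S : ℝ => S⁻¹ * ∫ t in 0..S, inner ℝ (gradient φ (x t)) (v t)) atTop (𝓝 0) := by
  refine (tendsto_mul_sub_of_abs_le 0 tendsto_inv_atTop_zero hB).congr' ?_
  filter_upwards [eventually_ge_atTop 0] with S hS
  rw [hx.integral_inner_gradient hφ hS]

theorem setIntegral_exp_mul_inner_gradient_eq_zero (hx : IsACSolution x v) (hφ : ContDiff ℝ 1 φ)
    {B C : ℝ} (hB : ∀ t, |φ (x t)| ≤ B) (hC : 0 < C)
    (hint : IntegrableOn (fun t => Real.exp (-C * t) *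
        (inner ℝ (gradient φ (x t)) (v t) + C * (φ (x 0) - φ (x t)))) (Ici 0)) :
    ∫ t in Ici (0 : ℝ), Real.exp (-C * t) *
        (inner ℝ (gradient φ (x t)) (v t) + C * (φ (x 0) - φ (x t))) = 0 := by
  rw [integral_Ici_eq_integral_Ioi]
  refine tendsto_nhds_unique (intervalIntegral_tendsto_integral_Ioi 0
    (hint.mono_set Ioi_subset_Ici_self) tendsto_id) ?_
  have hexp : Tendsto (fun S : ℝ => Real.exp (-C * S)) atTop (𝓝 0) :=
    Real.tendsto_exp_atBot.comp (tendsto_id.const_mul_atTop_of_neg (neg_lt_zero.2 hC))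
  refine (tendsto_mul_sub_of_abs_le 0 hexp hB).congr' ?_
  filter_upwards [eventually_ge_atTop 0] with S hS
  exact (hx.integral_exp_mul_inner_gradient hφ C hS).symm

end IsACSolution

namespace Problem

variable {U : Type*} [MetricSpace U] {m n : ℕ} {P : Problem U m n}

instance compactSpace_Y : CompactSpace P.Y := isCompact_iff_compactSpace.1 P.isCompact_Y

instance compactSpace_Z : CompactSpace P.Z := isCompact_iff_compactSpace.1 P.isCompact_Z

theorem continuous_comp_coe {V : Type*} [TopologicalSpace V] {F : U × E m × E n → V}
    (hF : Continuous F) :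
    Continuous fun x : (U × P.Y) × P.Z => F (x.1.1, (x.1.2 : E m), (x.2 : E n)) :=
  hF.comp (by fun_prop)

theorem continuous_inner_gradient_g {ζ : E n → ℝ} (hζ : ContDiff ℝ 1 ζ) :
    Continuous fun x : (U × P.Y) × P.Z =>
      (inner ℝ (gradient ζ x.2) (P.g x.1.1 x.1.2 x.2) : ℝ) := by
  have hgrad := continuous_gradient_of_contDiff hζ
  exact Continuous.inner (by fun_prop) (continuous_comp_coe P.continuous_g)

theorem continuous_inner_gradient_f {η : E m → ℝ} (hη : ContDiff ℝ 1 η) :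
    Continuous fun x : (U × P.Y) × P.Z =>
      (inner ℝ (gradient η x.1.2) (P.f x.1.1 x.1.2 x.2) : ℝ) := by
  have hgrad := continuous_gradient_of_contDiff hη
  exact Continuous.inner (by fun_prop) (continuous_comp_coe P.continuous_f)

theorem continuous_dualIntegrand {ζ : E n → ℝ} (hζ : ContDiff ℝ 1 ζ) {η : E m → ℝ}
    (hη : ContDiff ℝ 1 η) :
    Continuous fun x : (U × P.Y) × P.Z => P.dualIntegrand ζ η x.1.1 x.1.2 x.2 :=
  ((continuous_comp_coe P.continuous_G).add (continuous_inner_gradient_g hζ)).add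
    (continuous_inner_gradient_f hη)

theorem continuous_G_add_inner_g (q : E n) (z : P.Z) :
    Continuous fun w : U × P.Y => P.G w.1 w.2 z + inner ℝ q (P.g w.1 w.2 z) :=
  ((continuous_comp_coe P.continuous_G).comp (.prodMk_left z)).add
    (continuous_const.inner ((continuous_comp_coe P.continuous_g).comp (.prodMk_left z)))

variable [MeasurableSpace U]

section Hamiltonian

variable [BorelSpace U] [CompactSpace U]

theorem integral_inner_g (μ : ProbabilityMeasure (U × P.Y)) (z : P.Z) (q : E n) :
    ∫ w, inner ℝ q (P.g w.1 w.2 z) ∂(μ : Measure (U × P.Y)) = inner ℝ q (P.gTilde μ z) :=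
  integral_inner (integrable_of_continuous_of_compactSpace _
    ((continuous_comp_coe P.continuous_g).comp (.prodMk_left z))) q

theorem integral_G_add_inner_g (μ : ProbabilityMeasure (U × P.Y)) (z : P.Z) (q : E n) :
    ∫ w, (P.G w.1 w.2 z + inner ℝ q (P.g w.1 w.2 z)) ∂(μ : Measure (U × P.Y)) =
      P.GTilde μ z + inner ℝ q (P.gTilde μ z) := by
  have hG := (continuous_comp_coe P.continuous_G).comp (.prodMk_left z)
  have hg := (continuous_comp_coe P.continuous_g).comp (.prodMk_left z)
  rw [← integral_inner_g]
  exact integral_add (integrable_of_continuous_of_compactSpace _ hG)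
    (integrable_of_continuous_of_compactSpace _ (continuous_const.inner hg))

theorem bddBelow_range_GTilde_add_inner_gTilde (q : E n) (z : P.Z) :
    BddBelow (range fun μ => P.GTilde μ z + inner ℝ q (P.gTilde μ z)) := by
  obtain ⟨B, hB⟩ := isCompact_univ.exists_bound_of_continuousOn
    (continuous_G_add_inner_g q z).continuousOn
  refine ⟨-B, ?_⟩
  rintro _ ⟨μ, rfl⟩
  have hnorm := norm_integral_le_of_norm_le_const (μ := (μ : Measure (U × P.Y)))
    (.of_forall fun w => hB w (mem_univ w))
  have habs : |P.GTilde μ z + inner ℝ q (P.gTilde μ z)| ≤ B := by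
    rw [← integral_G_add_inner_g]
    simpa using hnorm
  exact (abs_le.1 habs).1

theorem HTilde_le {z : P.Z} {μ : ProbabilityMeasure (U × P.Y)} (hμ : μ ∈ P.W z) (q : E n) :
    P.HTilde q z ≤ P.GTilde μ z + inner ℝ q (P.gTilde μ z) :=
  csInf_le ((bddBelow_range_GTilde_add_inner_gTilde q z).mono (image_subset_range _ _))
    ⟨μ, hμ, rfl⟩

theorem integral_dualIntegrand_of_mem_W {z : P.Z} {μ : ProbabilityMeasure (U × P.Y)}
    (hμ : μ ∈ P.W z) {ζ : E n → ℝ} {η : E m → ℝ} (hη : ContDiff ℝ 1 η) :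
    ∫ w, P.dualIntegrand ζ η w.1 w.2 z ∂(μ : Measure (U × P.Y)) =
      P.GTilde μ z + inner ℝ (gradient ζ z) (P.gTilde μ z) := by
  refine (integral_add
    (integrable_of_continuous_of_compactSpace _ (continuous_G_add_inner_g (gradient ζ z) z))
    (integrable_of_continuous_of_compactSpace _
      ((continuous_inner_gradient_f hη).comp (.prodMk_left z)))).trans ?_
  rw [integral_G_add_inner_g]
  exact add_eq_left.2 (hμ η hη)

end Hamiltonian

section Associated

variable {z : P.Z} {u : ℝ → U} {y : ℝ → P.Y}

theorem IsAssociatedAdmissible.aemeasurable_pair (h : P.IsAssociatedAdmissible z u y) :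
    AEMeasurable (fun τ => (u τ, y τ)) (volume.restrict (Ici (0 : ℝ))) :=
  h.1.prodMk h.2.aemeasurable_of_subtype

theorem IsAssociatedAdmissible.integrableOn_Icc [BorelSpace U] [CompactSpace U]
    (h : P.IsAssociatedAdmissible z u y) (q : C(U × P.Y, ℝ)) (T : ℝ) :
    IntegrableOn (fun τ => q (u τ, y τ)) (Icc 0 T) :=
  .of_bound measure_Icc_lt_top
    (q.continuous.measurable.comp_aemeasurable <| h.aemeasurable_pair.mono_measure <|
      Measure.restrict_mono Icc_subset_Ici_self le_rfl).aestronglyMeasurable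
    ‖q‖ (.of_forall fun _ => q.norm_coe_le_norm _)

variable {μ : ProbabilityMeasure (U × P.Y)}

theorem IsOccupationalMeasure.mem_W (hμ : P.IsOccupationalMeasure u y μ)
    (h : P.IsAssociatedAdmissible z u y) : μ ∈ P.W z := by
  intro φ hφ
  obtain ⟨B, hB⟩ := P.isCompact_Y.exists_bound_of_continuousOn hφ.continuous.continuousOn
  exact tendsto_nhds_unique
    (hμ ⟨_, (continuous_inner_gradient_f hφ).comp (.prodMk_left z)⟩)
    (h.2.tendsto_average_inner_gradient hφ fun τ => hB _ (y τ).2)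

variable [BorelSpace U] [CompactSpace U]

theorem IsOccupationalMeasure.setIntegral_period (hμ : P.IsOccupationalMeasure u y μ)
    (h : P.IsAssociatedAdmissible z u y) {T : ℝ} (hper : IsPeriodicPair T u y)
    (q : C(U × P.Y, ℝ)) :
    ∫ τ in Icc 0 T, q (u τ, y τ) = T * ∫ w, q w ∂(μ : Measure (U × P.Y)) := by
  obtain ⟨hT, hper⟩ := hper
  rw [integral_Icc_eq_integral_Ioc, ← intervalIntegral.integral_of_le hT.le]
  exact intervalIntegral_period_eq_of_tendsto_average hT
    (fun τ hτ => by rw [(hper τ hτ).1, (hper τ hτ).2])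
    ((intervalIntegrable_iff_integrableOn_Icc_of_le hT.le).2 (h.integrableOn_Icc q T)) (hμ q)

theorem IsOccupationalMeasure.ae_isMinOn (hμ : P.IsOccupationalMeasure u y μ)
    (h : P.IsAssociatedAdmissible z u y) {ζ : E n → ℝ} (hζ : ContDiff ℝ 1 ζ) {η : E m → ℝ}
    (hη : P.IsAssociatedDualSolution ζ z η) {T : ℝ} (hper : IsPeriodicPair T u y)
    (hmin : P.GTilde μ z + inner ℝ (gradient ζ z) (P.gTilde μ z) = P.HTilde (gradient ζ z) z) :
    ∀ᵐ τ ∂(volume.restrict (Icc (0 : ℝ) T)),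
      IsMinOn (fun v : U => P.dualIntegrand ζ η v (y τ) z) univ (u τ) := by
  let q : C(U × P.Y, ℝ) := ⟨_, (continuous_dualIntegrand hζ hη.1).comp (.prodMk_left z)⟩
  have hq : ∫ w, q w ∂(μ : Measure (U × P.Y)) = P.HTilde (gradient ζ z) z :=
    (integral_dualIntegrand_of_mem_W (hμ.mem_W h) hη.1).trans hmin
  have hperiod : ∫ τ in Icc 0 T, 1 * q (u τ, y τ) =
      (∫ _ in Icc 0 T, (1 : ℝ)) * P.HTilde (gradient ζ z) z := by
    simpa [hper.1.le, hq] using hμ.setIntegral_period h hper q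
  have hconst : ∀ᵐ τ ∂(volume.restrict (Icc (0 : ℝ) T)),
      q (u τ, y τ) = P.HTilde (gradient ζ z) z :=
    ae_eq_const_of_integral_mul_le (.of_forall fun _ => zero_lt_one) (integrable_const 1)
      (by simpa only [one_mul, IntegrableOn] using h.integrableOn_Icc q T)
      (.of_forall fun τ => hη.2 (u τ) (y τ)) hperiod.le
  filter_upwards [hconst] with τ hτ v _ using hτ.trans_le (hη.2 v (y τ))

end Associated

section Averaged

variable [BorelSpace U] [CompactSpace U] {μ : ℝ → ProbabilityMeasure (U × P.Y)} {z : ℝ → P.Z}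

theorem IsAveragedAdmissible.integrableOn_exp_mul_integral (h : P.IsAveragedAdmissible μ z)
    {q : (U × P.Y) × P.Z → ℝ} (hq : Continuous q) :
    IntegrableOn (fun t => Real.exp (-P.C * t) * ∫ w, q (w, z t) ∂(μ t : Measure (U × P.Y)))
      (Ici 0) :=
  integrable_mul_integral_probabilityMeasure (integrableOn_exp_neg_mul_Ici P.C_pos 0) h.1
    h.2.2.aemeasurable_of_subtype hq

theorem IsAveragedAdmissible.integrableOn_exp_mul_inner_gradient
    (h : P.IsAveragedAdmissible μ z) {φ : E n → ℝ} (hφ : ContDiff ℝ 1 φ) :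
    IntegrableOn (fun t => Real.exp (-P.C * t) *
      (inner ℝ (gradient φ (z t)) (P.gTilde (μ t) (z t)) + P.C * (φ (z 0) - φ (z t)))) (Ici 0) := by
  have hg := h.integrableOn_exp_mul_integral (continuous_inner_gradient_g hφ)
  have hφ_cont := hφ.continuous
  have hdiff := h.integrableOn_exp_mul_integral
    (q := fun x => P.C * (φ (z 0) - φ x.2)) (by fun_prop)
  simp only [integral_inner_g] at hg
  simp only [integral_const, probReal_univ, one_smul] at hdiff
  simp only [mul_add]
  exact hg.add hdiff

theorem IsAveragedAdmissible.setIntegral_exp_mul_inner_gradient_eq_zero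
    (h : P.IsAveragedAdmissible μ z) {φ : E n → ℝ} (hφ : ContDiff ℝ 1 φ) :
    ∫ t in Ici (0 : ℝ), Real.exp (-P.C * t) *
      (inner ℝ (gradient φ (z t)) (P.gTilde (μ t) (z t)) + P.C * (φ (z 0) - φ (z t))) = 0 := by
  obtain ⟨B, hB⟩ := P.isCompact_Z.exists_bound_of_continuousOn hφ.continuous.continuousOn
  exact h.2.2.setIntegral_exp_mul_inner_gradient_eq_zero hφ (fun t => hB _ (z t).2) P.C_pos
    (h.integrableOn_exp_mul_inner_gradient hφ)

theorem IsAveragedAdmissible.integrableOn_exp_mul_GTilde (h : P.IsAveragedAdmissible μ z) :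
    IntegrableOn (fun t => Real.exp (-P.C * t) * P.GTilde (μ t) (z t)) (Ici 0) :=
  h.integrableOn_exp_mul_integral (continuous_comp_coe P.continuous_G)

theorem IsAveragedAdmissible.integrableOn_exp_mul_GTilde_add (h : P.IsAveragedAdmissible μ z)
    {φ : E n → ℝ} (hφ : ContDiff ℝ 1 φ) :
    IntegrableOn (fun t => Real.exp (-P.C * t) * (P.GTilde (μ t) (z t) +
      (inner ℝ (gradient φ (z t)) (P.gTilde (μ t) (z t)) + P.C * (φ (z 0) - φ (z t)))))
      (Ici 0) := by
  simp only [mul_add _ (P.GTilde _ _)]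
  exact h.integrableOn_exp_mul_GTilde.add (h.integrableOn_exp_mul_inner_gradient hφ)

theorem IsAveragedAdmissible.setIntegral_exp_mul_GTilde_add (h : P.IsAveragedAdmissible μ z)
    {φ : E n → ℝ} (hφ : ContDiff ℝ 1 φ) :
    ∫ t in Ici (0 : ℝ), Real.exp (-P.C * t) * (P.GTilde (μ t) (z t) +
      (inner ℝ (gradient φ (z t)) (P.gTilde (μ t) (z t)) + P.C * (φ (z 0) - φ (z t)))) =
      P.averagedCost μ z := by
  simp only [mul_add _ (P.GTilde _ _)]
  rw [integral_add h.integrableOn_exp_mul_GTilde (h.integrableOn_exp_mul_inner_gradient hφ),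
    h.setIntegral_exp_mul_inner_gradient_eq_zero hφ, add_zero, averagedCost]

theorem IsAveragedAdmissible.ae_eq_HTilde (h : P.IsAveragedAdmissible μ z) {ζ : E n → ℝ}
    (hζ : P.IsAveragedDualSolution (z 0) ζ)
    (hcost : P.C * P.averagedCost μ z ≤ P.averagedLPValue (z 0)) :
    ∀ᵐ t ∂(volume.restrict (Ici (0 : ℝ))),
      P.GTilde (μ t) (z t) + inner ℝ (gradient ζ (z t)) (P.gTilde (μ t) (z t)) =
        P.HTilde (gradient ζ (z t)) (z t) := by
  have hHTilde : ∀ᵐ t ∂(volume.restrict (Ici (0 : ℝ))), P.HTilde (gradient ζ (z t)) (z t) ≤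
      P.GTilde (μ t) (z t) + inner ℝ (gradient ζ (z t)) (P.gTilde (μ t) (z t)) := by
    filter_upwards [h.2.1] with t ht using HTilde_le ht _
  have hlower : ∀ᵐ t ∂(volume.restrict (Ici (0 : ℝ))), P.averagedLPValue (z 0) ≤
      P.GTilde (μ t) (z t) + (inner ℝ (gradient ζ (z t)) (P.gTilde (μ t) (z t)) +
        P.C * (ζ (z 0) - ζ (z t))) := by
    filter_upwards [hHTilde] with t ht
    linarith [hζ.2 (z t)]
  have hmean : ∫ t in Ici (0 : ℝ), Real.exp (-P.C * t) * (P.GTilde (μ t) (z t) +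
      (inner ℝ (gradient ζ (z t)) (P.gTilde (μ t) (z t)) + P.C * (ζ (z 0) - ζ (z t)))) ≤
      (∫ t in Ici (0 : ℝ), Real.exp (-P.C * t)) * P.averagedLPValue (z 0) := by
    rw [h.setIntegral_exp_mul_GTilde_add hζ.1, integral_exp_neg_mul_Ici_zero P.C_pos]
    exact (le_inv_mul_iff₀ P.C_pos).2 hcost
  have hconst := ae_eq_const_of_integral_mul_le (.of_forall fun t => Real.exp_pos (-P.C * t))
    (integrableOn_exp_neg_mul_Ici P.C_pos 0) (h.integrableOn_exp_mul_GTilde_add hζ.1) hlower hmean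
  filter_upwards [hconst, hHTilde] with t ht hHt
  linarith [hζ.2 (z t)]

end Averaged

theorem IsACGFamily.isAveragedAdmissible [BorelSpace U] {z₀ : P.Z} {u : P.Z → ℝ → U}
    {y : P.Z → ℝ → P.Y} {μ : P.Z → ProbabilityMeasure (U × P.Y)} {zt : ℝ → P.Z}
    (h : P.IsACGFamily z₀ u y μ zt) : P.IsAveragedAdmissible (fun t => μ (zt t)) zt := by
  have hμ : Measurable μ := measurable_probabilityMeasure_of_integral fun q =>
    h.measurable (q.comp ⟨fun x => (x.1, x.2.1), by fun_prop⟩)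
  exact ⟨hμ.comp_aemeasurable h.solution.2.aemeasurable_of_subtype,
    .of_forall fun t => (h.occupational _).mem_W (h.admissible _), h.solution.2⟩

end Problem

end SlowFast

theorem mainTheorem8_general {U : Type*} [MetricSpace U] [CompactSpace U] [MeasurableSpace U]
    [BorelSpace U] {m n : ℕ} (P : SlowFast.Problem U m n)
    (μ : ℝ → ProbabilityMeasure (U × P.Y)) (z : ℝ → P.Z) (hμz : P.IsAveragedAdmissible μ z)
    (hcost : P.C * P.averagedCost μ z ≤ P.averagedLPValue (z 0))
    (ζ : SlowFast.E n → ℝ) (hζ : P.IsAveragedDualSolution (z 0) ζ)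
    (u : ℝ → ℝ → U) (y : ℝ → ℝ → P.Y) (η : ℝ → SlowFast.E m → ℝ) (T : ℝ → ℝ)
    (hadm : ∀ᵐ t ∂(volume.restrict (Ici (0 : ℝ))), P.IsAssociatedAdmissible (z t) (u t) (y t))
    (hocc : ∀ᵐ t ∂(volume.restrict (Ici (0 : ℝ))), P.IsOccupationalMeasure (u t) (y t) (μ t))
    (hη : ∀ᵐ t ∂(volume.restrict (Ici (0 : ℝ))), P.IsAssociatedDualSolution ζ (z t) (η t))
    (hper : ∀ᵐ t ∂(volume.restrict (Ici (0 : ℝ))), SlowFast.IsPeriodicPair (T t) (u t) (y t)) :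
    ∀ᵐ t ∂(volume.restrict (Ici (0 : ℝ))), ∀ᵐ τ ∂(volume.restrict (Icc (0 : ℝ) (T t))),
      IsMinOn (fun v : U => P.dualIntegrand ζ (η t) v (y t τ) (z t)) univ (u t τ) := by
  filter_upwards [hμz.ae_eq_HTilde hζ hcost, hadm, hocc, hη, hper]
    with t hmin hadm hocc hη hper using hocc.ae_isMinOn hadm hζ.1 hη hper hmin

theorem mainTheorem8 {U : Type*} [MetricSpace U] [CompactSpace U] [MeasurableSpace U]
    [BorelSpace U] {m n : ℕ} (P : SlowFast.Problem U m n) (z₀ : P.Z)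
    (hvalue : P.C * P.averagedValue z₀ = P.averagedLPValue z₀)
    (ζ : SlowFast.E n → ℝ) (hζ : P.IsAveragedDualSolution z₀ ζ)
    (η : P.Z → SlowFast.E m → ℝ) (hη : ∀ z : P.Z, P.IsAssociatedDualSolution ζ z (η z))
    (u : P.Z → ℝ → U) (y : P.Z → ℝ → P.Y) (μ : P.Z → ProbabilityMeasure (U × P.Y))
    (zt : ℝ → P.Z) (hACG : P.IsACGFamily z₀ u y μ zt)
    (T : P.Z → ℝ)
    (hper : ∀ t : ℝ, 0 ≤ t → SlowFast.IsPeriodicPair (T (zt t)) (u (zt t)) (y (zt t)))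
    (hopt : P.IsOptimalACG z₀ μ zt) :
    ∀ᵐ t ∂(volume.restrict (Ici (0 : ℝ))),
      ∀ᵐ τ ∂(volume.restrict (Icc (0 : ℝ) (T (zt t)))),
        IsMinOn (fun v : U => P.dualIntegrand ζ (η (zt t)) v (y (zt t) τ) (zt t)) univ
          (u (zt t) τ) := by
  obtain ⟨rfl, -⟩ := hACG.solution
  exact mainTheorem8_general P _ zt hACG.isAveragedAdmissible (hopt ▸ hvalue.le) ζ hζ _ _ _ _
    (.of_forall fun _ => hACG.admissible _) (.of_forall fun _ => hACG.occupational _)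
    (.of_forall fun _ => hη _) (ae_restrict_of_forall_mem measurableSet_Ici hper)
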